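/- **Proposition 3.14.** Let $n$ be a natural number, let $A, B, X$ be $n\times n$ complex matrices with $A$ and $B$ positive semidefinite, and let $|||\cdot|||$ be a unitarily invariant norm on the $n\times n$ complex matrices, that is, a norm with $|||UMV|||=|||M|||$ for all matrices $M$ and all unitary matrices $U,V$. Let $0<\nu\le\frac12$, $r=\min\{\nu,1-\nu\}$ and $r_0=\min\{2r,1-2r\}$. Then $$\begin{aligned} |||A^{1-\nu}XB^{\nu}+A^{\nu}XB^{1-\nu}||| \le{}& (1-2\nu)\bigl(|||AX|||+|||XB|||\bigr)+\Bigl(2\bigl(2\nu\sqrt{|||AX|||\,|||XB|||}\bigr)\\ &-r_0\Bigl(\bigl(\sqrt{|||AX|||}-\sqrt[4]{|||AX|||\,|||XB|||}\bigr)^2+\bigl(\sqrt{|||XB|||}-\sqrt[4]{|||AX|||\,|||XB|||}\bigr)^2\Bigr)\Bigr), \end{aligned}$$ where the powers $A^t$, $B^t$ are those of the functional calculus for positive semidefinite matrices. -/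

import Mathlib

open scoped ComplexOrder

/-- The real power `A ^ t` of a positive semidefinite matrix `A`, by the spectral functional
calculus: the function `x ↦ x ^ t` is applied to the eigenvalues of `A`. -/
noncomputable def matrixRpow {n : ℕ} (A : Matrix (Fin n) (Fin n) ℂ) (t : ℝ) :
    Matrix (Fin n) (Fin n) ℂ :=
  cfc (fun x : ℝ => x ^ t) A

/-- `N` is a unitarily invariant norm on the `n × n` complex matrices: a seminorm (nonnegative,
absolutely homogeneous, subadditive) that vanishes only at `0`, with `N (U * M * V) = N M` for all
matrices `M` and all unitary matrices `U`, `V`. -/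
structure IsUnitarilyInvariantNorm {n : ℕ} (N : Seminorm ℂ (Matrix (Fin n) (Fin n) ℂ)) :
    Prop where
  eq_zero : ∀ M : Matrix (Fin n) (Fin n) ℂ, N M = 0 → M = 0
  unitary_mul_mul : ∀ M : Matrix (Fin n) (Fin n) ℂ,
    ∀ U ∈ Matrix.unitaryGroup (Fin n) ℂ, ∀ V ∈ Matrix.unitaryGroup (Fin n) ℂ,
      N (U * M * V) = N M

/-!
The function `z ↦ A ^ (1 - z) X B ^ z`, read as `0` on the kernels of `A` and `B`, is entire and
bounded on the strip `0 ≤ re z ≤ 1`. On the line `re z = 0` it is `A X` multiplied on both sides by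
contractions, on `re z = 1` it is `X B` multiplied by contractions, and contractions do not increase
a unitarily invariant seminorm. The three lines theorem thus gives
`N (A ^ (1 - t) X B ^ t) ≤ a ^ (1 - t) * b ^ t` with `a = N (A X)` and `b = N (X B)`.

What is left is scalar: since `a ^ (1 - ν) * b ^ ν = a ^ (1 - 2 * ν) * √(a * b) ^ (2 * ν)`, the
Kittaneh–Manasrah refinement of Young's inequality applies to `a` and `√(a * b)` with weight
`2 * ν`. This, the same with `a` and `b` exchanged, and the triangle inequality give the bound.
-/

open Matrix

section ThreeLines

open Complex Complex.HadamardThreeLines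

lemma seminorm_sum_smul_le_interp {E ι : Type*} [AddCommGroup E] [Module ℂ E]
    (N : Seminorm ℂ E) (s : Finset ι) {c : ι → ℂ → ℂ} (m : ι → E) {C : ι → ℝ}
    (hd : ∀ i ∈ s, Differentiable ℂ (c i))
    (hC : ∀ i ∈ s, ∀ z ∈ verticalClosedStrip 0 1, ‖c i z‖ ≤ C i)
    {a b t : ℝ} (ht : t ∈ Set.Icc 0 1)
    (ha : ∀ z : ℂ, z.re = 0 → N (∑ i ∈ s, c i z • m i) ≤ a)
    (hb : ∀ z : ℂ, z.re = 1 → N (∑ i ∈ s, c i z • m i) ≤ b) :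
    N (∑ i ∈ s, c i t • m i) ≤ a ^ (1 - t) * b ^ t := by
  -- The three lines theorem needs a norm, so pass to the quotient by the kernel of `N`.
  let _ : SeminormedAddCommGroup E := N.toAddGroupSeminorm.toSeminormedAddCommGroup
  let _ : NormedSpace ℂ E := ⟨fun k x => (map_smul_eq_mul N k x).le⟩
  let q : E →L[ℂ] SeparationQuotient E := SeparationQuotient.mkCLM ℂ E
  let F : ℂ → SeparationQuotient E := fun z => ∑ i ∈ s, c i z • q (m i)
  have norm_F (z : ℂ) : ‖F z‖ = N (∑ i ∈ s, c i z • m i) := by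
    have : F z = q (∑ i ∈ s, c i z • m i) := by simp only [F, map_sum, map_smul]
    rw [this]
    exact SeparationQuotient.norm_mk _
  have differentiable_F : Differentiable ℂ F :=
    Differentiable.fun_sum fun i hi => (hd i hi).smul_const _
  have bddAbove_F : BddAbove ((norm ∘ F) '' verticalClosedStrip 0 1) := by
    refine ⟨∑ i ∈ s, C i * ‖q (m i)‖, ?_⟩
    rintro _ ⟨z, hz, rfl⟩
    refine norm_sum_le_of_le s fun i hi => ?_
    rw [norm_smul]
    exact mul_le_mul_of_nonneg_right (hC i hi z hz) (norm_nonneg _)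
  have three_lines := norm_le_interp_of_mem_verticalClosedStrip₀₁' F (z := (t : ℂ)) (a := a)
    (b := b) ht differentiable_F.diffContOnCl bddAbove_F
    (fun z hz => (norm_F z).trans_le (ha z hz)) (fun z hz => (norm_F z).trans_le (hb z hz))
  rwa [norm_F, ofReal_re] at three_lines

end ThreeLines

section SupportCpow

/-- The complex power `x ^ z` of a real number, with value `0` at `x = 0` for every exponent. Unlike
`Complex.cpow`, where `0 ^ 0 = 1`, it is entire in `z` also for `x = 0`. -/
noncomputable def supportCpow (x : ℝ) (z : ℂ) : ℂ :=
  if x = 0 then 0 else Complex.exp (z * Real.log x)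

lemma differentiable_supportCpow (x : ℝ) : Differentiable ℂ (supportCpow x) := by
  unfold supportCpow
  split_ifs <;> fun_prop

lemma norm_supportCpow_le (x : ℝ) (z : ℂ) :
    ‖supportCpow x z‖ ≤ Real.exp (z.re * Real.log x) := by
  unfold supportCpow
  split_ifs
  · rw [norm_zero]
    positivity
  · rw [Complex.norm_exp, Complex.re_mul_ofReal]

lemma norm_supportCpow_le_one (x : ℝ) {z : ℂ} (hz : z.re = 0) : ‖supportCpow x z‖ ≤ 1 := by
  simpa only [hz, zero_mul, Real.exp_zero] using norm_supportCpow_le x z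

lemma norm_supportCpow_le_exp_abs_log (x : ℝ) {z : ℂ} (hz : z.re ∈ Set.Icc 0 1) :
    ‖supportCpow x z‖ ≤ Real.exp |Real.log x| := by
  refine (norm_supportCpow_le x z).trans (Real.exp_le_exp.2 ?_)
  calc z.re * Real.log x ≤ z.re * |Real.log x| := mul_le_mul_of_nonneg_left (le_abs_self _) hz.1
    _ ≤ |Real.log x| := mul_le_of_le_one_left (abs_nonneg _) hz.2

lemma supportCpow_add_one {x : ℝ} (hx : 0 ≤ x) (z : ℂ) :
    supportCpow x (z + 1) = supportCpow x z * x := by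
  rcases hx.eq_or_lt with rfl | hx
  · simp [supportCpow]
  · rw [supportCpow, supportCpow, if_neg hx.ne', if_neg hx.ne', add_mul, Complex.exp_add, one_mul,
      ← Complex.ofReal_exp, Real.exp_log hx]

lemma supportCpow_ofReal {x t : ℝ} (hx : 0 ≤ x) (ht : t ≠ 0) :
    supportCpow x t = ((x ^ t : ℝ) : ℂ) := by
  rcases hx.eq_or_lt with rfl | hx
  · simp [supportCpow, Real.zero_rpow ht]
  · rw [supportCpow, if_neg hx.ne', Real.rpow_def_of_pos hx, Complex.ofReal_exp,
      Complex.ofReal_mul, mul_comm]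

end SupportCpow

section UnitarilyInvariant

variable {m k : Type*} [Fintype m] [DecidableEq m] [Fintype k] [DecidableEq k]

lemma exists_norm_eq_one_half_mul_add {z : ℂ} (hz : ‖z‖ ≤ 1) :
    ∃ u v : ℂ, ‖u‖ = 1 ∧ ‖v‖ = 1 ∧ z = 1 / 2 * (u + v) := by
  -- Write `z = cos φ * exp (θ * I)`; then `u` and `v` are `exp ((θ ± φ) * I)`.
  set θ : ℝ := z.arg
  set φ : ℝ := Real.arccos ‖z‖
  have cos_φ : Complex.cos φ = ‖z‖ := by
    rw [← Complex.ofReal_cos, Real.cos_arccos (by linarith [norm_nonneg z]) hz]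
  refine ⟨Complex.exp ((θ + φ : ℝ) * Complex.I), Complex.exp ((θ - φ : ℝ) * Complex.I),
    Complex.norm_exp_ofReal_mul_I _, Complex.norm_exp_ofReal_mul_I _, ?_⟩
  calc z = Complex.cos φ * Complex.exp (θ * Complex.I) := by
        rw [cos_φ, Complex.norm_mul_exp_arg_mul_I]
    _ = 1 / 2 * (Complex.exp ((θ + φ : ℝ) * Complex.I) +
          Complex.exp ((θ - φ : ℝ) * Complex.I)) := by
        rw [Complex.cos, Complex.ofReal_add, Complex.ofReal_sub, add_mul, sub_mul, sub_eq_add_neg,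
          Complex.exp_add, Complex.exp_add, neg_mul]
        ring

lemma diagonal_mem_unitaryGroup {d : m → ℂ} (hd : ∀ i, ‖d i‖ = 1) :
    diagonal d ∈ unitaryGroup m ℂ := by
  rw [mem_unitaryGroup_iff, star_eq_conjTranspose, diagonal_conjTranspose, diagonal_mul_diagonal,
    ← diagonal_one]
  congr 1
  ext i
  simp [Complex.mul_conj, Complex.normSq_eq_norm_sq, hd]

lemma exists_unitary_half_smul_add_eq_diagonal {d : m → ℂ} (hd : ∀ i, ‖d i‖ ≤ 1) :
    ∃ U ∈ unitaryGroup m ℂ, ∃ V ∈ unitaryGroup m ℂ, (1 / 2 : ℂ) • (U + V) = diagonal d := by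
  choose u v hu hv huv using fun i => exists_norm_eq_one_half_mul_add (hd i)
  refine ⟨diagonal u, diagonal_mem_unitaryGroup hu, diagonal v, diagonal_mem_unitaryGroup hv, ?_⟩
  rw [diagonal_add, ← diagonal_smul]
  exact congrArg diagonal (funext fun i => (huv i).symm)

/-- Unitary invariance of a seminorm on rectangular complex matrices: multiplication by unitary
matrices on either side leaves it unchanged. This is the property `unitary_mul_mul` of
`IsUnitarilyInvariantNorm`, for arbitrary index types and without definiteness. -/
def IsUnitarilyInvariant (N : Seminorm ℂ (Matrix m k ℂ)) : Prop :=
  ∀ M : Matrix m k ℂ, ∀ U ∈ unitaryGroup m ℂ, ∀ V ∈ unitaryGroup k ℂ, N (U * M * V) = N M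

lemma seminorm_half_smul_add_le {E : Type*} [AddCommGroup E] [Module ℂ E] (N : Seminorm ℂ E)
    {x y : E} {a : ℝ} (hx : N x ≤ a) (hy : N y ≤ a) : N ((1 / 2 : ℂ) • (x + y)) ≤ a := by
  have norm_half : ‖(1 / 2 : ℂ)‖ = 1 / 2 := by norm_num
  rw [map_smul_eq_mul, norm_half]
  linarith [map_add_le_add N x y]

namespace IsUnitarilyInvariant

variable {N : Seminorm ℂ (Matrix m k ℂ)}

lemma diagonal_mul_le (hN : IsUnitarilyInvariant N) {d : m → ℂ} (hd : ∀ i, ‖d i‖ ≤ 1)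
    (M : Matrix m k ℂ) : N (diagonal d * M) ≤ N M := by
  have unitary_mul {U : Matrix m m ℂ} (hU : U ∈ unitaryGroup m ℂ) : N (U * M) = N M := by
    simpa only [Matrix.mul_one] using hN M U hU 1 (one_mem _)
  obtain ⟨U, hU, V, hV, hUV⟩ := exists_unitary_half_smul_add_eq_diagonal hd
  rw [← hUV, Matrix.smul_mul, Matrix.add_mul]
  exact seminorm_half_smul_add_le N (unitary_mul hU).le (unitary_mul hV).le

lemma mul_diagonal_le (hN : IsUnitarilyInvariant N) {d : k → ℂ} (hd : ∀ i, ‖d i‖ ≤ 1)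
    (M : Matrix m k ℂ) : N (M * diagonal d) ≤ N M := by
  have mul_unitary {U : Matrix k k ℂ} (hU : U ∈ unitaryGroup k ℂ) : N (M * U) = N M := by
    simpa only [Matrix.one_mul] using hN M 1 (one_mem _) U hU
  obtain ⟨U, hU, V, hV, hUV⟩ := exists_unitary_half_smul_add_eq_diagonal hd
  rw [← hUV, Matrix.mul_smul, Matrix.mul_add]
  exact seminorm_half_smul_add_le N (mul_unitary hU).le (mul_unitary hV).le

lemma diagonal_mul_mul_diagonal_le (hN : IsUnitarilyInvariant N) {c : m → ℂ} {d : k → ℂ}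
    (hc : ∀ i, ‖c i‖ ≤ 1) (hd : ∀ i, ‖d i‖ ≤ 1) (M : Matrix m k ℂ) :
    N (diagonal c * M * diagonal d) ≤ N M :=
  (hN.mul_diagonal_le hd _).trans (hN.diagonal_mul_le hc M)

end IsUnitarilyInvariant

/-- The analytic family `D ^ (1 - z) * Y * E ^ z`, for the diagonal matrices `D` and `E` with
entries `x` and `y`, that interpolates between `D * Y` and `Y * E`. The powers are `supportCpow`. -/
noncomputable def diagonalInterpolant (x : m → ℝ) (y : k → ℝ) (Y : Matrix m k ℂ) (z : ℂ) :
    Matrix m k ℂ :=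
  diagonal (fun i => supportCpow (x i) (1 - z)) * Y * diagonal fun j => supportCpow (y j) z

lemma diagonalInterpolant_eq_sum (x : m → ℝ) (y : k → ℝ) (Y : Matrix m k ℂ) (z : ℂ) :
    diagonalInterpolant x y Y z = ∑ p : m × k,
      (supportCpow (x p.1) (1 - z) * supportCpow (y p.2) z) • single p.1 p.2 (Y p.1 p.2) := by
  rw [Fintype.sum_prod_type, matrix_eq_sum_single (diagonalInterpolant x y Y z)]
  refine Finset.sum_congr rfl fun i _ => Finset.sum_congr rfl fun j _ => ?_
  rw [diagonalInterpolant, mul_diagonal, diagonal_mul, smul_single, smul_eq_mul, mul_right_comm]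

lemma diagonalInterpolant_ofReal {x : m → ℝ} {y : k → ℝ} (hx : ∀ i, 0 ≤ x i) (hy : ∀ j, 0 ≤ y j)
    (Y : Matrix m k ℂ) {t : ℝ} (ht₀ : t ≠ 0) (ht₁ : t ≠ 1) :
    diagonalInterpolant x y Y t = diagonal (fun i => ((x i ^ (1 - t) : ℝ) : ℂ)) * Y *
      diagonal fun j => ((y j ^ t : ℝ) : ℂ) := by
  have ofReal_one_sub : 1 - (t : ℂ) = (1 - t : ℝ) := by push_cast; rfl
  simp only [diagonalInterpolant, ofReal_one_sub,
    supportCpow_ofReal (hx _) (sub_ne_zero.2 ht₁.symm), supportCpow_ofReal (hy _) ht₀]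

lemma diagonalInterpolant_eq_mul_diagonal_mul {x : m → ℝ} (hx : ∀ i, 0 ≤ x i) (y : k → ℝ)
    (Y : Matrix m k ℂ) (z : ℂ) :
    diagonalInterpolant x y Y z = diagonal (fun i => supportCpow (x i) (-z)) *
      (diagonal (fun i => (x i : ℂ)) * Y) * diagonal fun j => supportCpow (y j) z := by
  simp only [diagonalInterpolant, ← Matrix.mul_assoc, diagonal_mul_diagonal,
    ← supportCpow_add_one (hx _), neg_add_eq_sub]

lemma diagonalInterpolant_eq_mul_mul_diagonal (x : m → ℝ) {y : k → ℝ} (hy : ∀ j, 0 ≤ y j)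
    (Y : Matrix m k ℂ) (z : ℂ) :
    diagonalInterpolant x y Y z = diagonal (fun i => supportCpow (x i) (1 - z)) *
      (Y * diagonal fun j => (y j : ℂ)) * diagonal fun j => supportCpow (y j) (z - 1) := by
  simp only [diagonalInterpolant, Matrix.mul_assoc, diagonal_mul_diagonal,
    mul_comm (Complex.ofReal _), ← supportCpow_add_one (hy _), sub_add_cancel]

lemma cfc_eq_unitary_mul_diagonal_mul_star {A : Matrix m m ℂ} (hA : A.IsHermitian) (f : ℝ → ℝ) :
    cfc f A = (hA.eigenvectorUnitary : Matrix m m ℂ) *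
      diagonal (fun i => (f (hA.eigenvalues i) : ℂ)) *
      star (hA.eigenvectorUnitary : Matrix m m ℂ) := by
  rw [hA.cfc_eq, IsHermitian.cfc, Unitary.conjStarAlgAut_apply]
  rfl

namespace IsUnitarilyInvariant

variable {N : Seminorm ℂ (Matrix m k ℂ)}

lemma diagonal_rpow_mul_mul_le (hN : IsUnitarilyInvariant N) {x : m → ℝ} {y : k → ℝ}
    (hx : ∀ i, 0 ≤ x i) (hy : ∀ j, 0 ≤ y j) (Y : Matrix m k ℂ) {t : ℝ} (ht₀ : 0 < t)
    (ht₁ : t < 1) :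
    N (diagonal (fun i => ((x i ^ (1 - t) : ℝ) : ℂ)) * Y * diagonal fun j => ((y j ^ t : ℝ) : ℂ)) ≤
      N (diagonal (fun i => (x i : ℂ)) * Y) ^ (1 - t) *
        N (Y * diagonal fun j => (y j : ℂ)) ^ t := by
  have bound_re_zero (z : ℂ) (hz : z.re = 0) :
      N (diagonalInterpolant x y Y z) ≤ N (diagonal (fun i => (x i : ℂ)) * Y) := by
    rw [diagonalInterpolant_eq_mul_diagonal_mul hx]
    exact hN.diagonal_mul_mul_diagonal_le (fun i => norm_supportCpow_le_one _ (by simp [hz]))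
      (fun j => norm_supportCpow_le_one _ hz) _
  have bound_re_one (z : ℂ) (hz : z.re = 1) :
      N (diagonalInterpolant x y Y z) ≤ N (Y * diagonal fun j => (y j : ℂ)) := by
    rw [diagonalInterpolant_eq_mul_mul_diagonal x hy]
    exact hN.diagonal_mul_mul_diagonal_le (fun i => norm_supportCpow_le_one _ (by simp [hz]))
      (fun j => norm_supportCpow_le_one _ (by simp [hz])) _
  have norm_coeff_le (p : m × k) (z : ℂ)
      (hz : z ∈ Complex.HadamardThreeLines.verticalClosedStrip 0 1) :
      ‖supportCpow (x p.1) (1 - z) * supportCpow (y p.2) z‖ ≤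
        Real.exp |Real.log (x p.1)| * Real.exp |Real.log (y p.2)| := by
    have one_sub_mem : (1 - z).re ∈ Set.Icc 0 1 := by
      simpa only [Complex.sub_re, Complex.one_re] using Set.Icc.mem_iff_one_sub_mem.1 hz
    rw [norm_mul]
    gcongr
    · exact norm_supportCpow_le_exp_abs_log _ one_sub_mem
    · exact norm_supportCpow_le_exp_abs_log _ hz
  simp only [diagonalInterpolant_eq_sum] at bound_re_zero bound_re_one
  rw [← diagonalInterpolant_ofReal hx hy Y ht₀.ne' ht₁.ne, diagonalInterpolant_eq_sum]
  exact seminorm_sum_smul_le_interp N Finset.univ _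
    (fun p _ => ((differentiable_supportCpow _).comp (by fun_prop)).mul
      (differentiable_supportCpow _))
    (fun p _ => norm_coeff_le p) ⟨ht₀.le, ht₁.le⟩ bound_re_zero bound_re_one

lemma map_cfc_mul_mul_cfc (hN : IsUnitarilyInvariant N) {A : Matrix m m ℂ} {B : Matrix k k ℂ}
    (hA : A.IsHermitian) (hB : B.IsHermitian) (f g : ℝ → ℝ) (X : Matrix m k ℂ) :
    N (cfc f A * X * cfc g B) = N (diagonal (fun i => (f (hA.eigenvalues i) : ℂ)) *
      (star (hA.eigenvectorUnitary : Matrix m m ℂ) * X * (hB.eigenvectorUnitary : Matrix k k ℂ)) *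
      diagonal fun j => (g (hB.eigenvalues j) : ℂ)) := by
  rw [cfc_eq_unitary_mul_diagonal_mul_star hA, cfc_eq_unitary_mul_diagonal_mul_star hB]
  refine (congrArg N ?_).trans
    (hN _ _ hA.eigenvectorUnitary.2 _ (Unitary.star_mem hB.eigenvectorUnitary.2))
  simp only [Matrix.mul_assoc]

theorem cfc_rpow_mul_mul_le (hN : IsUnitarilyInvariant N) {A : Matrix m m ℂ} {B : Matrix k k ℂ}
    (hA : A.PosSemidef) (hB : B.PosSemidef) (X : Matrix m k ℂ) {t : ℝ} (ht₀ : 0 < t)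
    (ht₁ : t < 1) :
    N (cfc (fun x : ℝ => x ^ (1 - t)) A * X * cfc (fun x : ℝ => x ^ t) B) ≤
      N (A * X) ^ (1 - t) * N (X * B) ^ t := by
  set Y : Matrix m k ℂ := star (hA.1.eigenvectorUnitary : Matrix m m ℂ) * X *
    (hB.1.eigenvectorUnitary : Matrix k k ℂ)
  have map_mul_left : N (A * X) = N (diagonal (fun i => (hA.1.eigenvalues i : ℂ)) * Y) := by
    have h := hN.map_cfc_mul_mul_cfc hA.1 hB.1 id 1 X
    rw [cfc_id ℝ A hA.1.isSelfAdjoint, cfc_one ℝ B hB.1.isSelfAdjoint] at h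
    simpa using h
  have map_mul_right : N (X * B) = N (Y * diagonal fun j => (hB.1.eigenvalues j : ℂ)) := by
    have h := hN.map_cfc_mul_mul_cfc hA.1 hB.1 1 id X
    rw [cfc_one ℝ A hA.1.isSelfAdjoint, cfc_id ℝ B hB.1.isSelfAdjoint] at h
    simpa using h
  rw [hN.map_cfc_mul_mul_cfc hA.1 hB.1, map_mul_left, map_mul_right]
  exact hN.diagonal_rpow_mul_mul_le hA.eigenvalues_nonneg hB.eigenvalues_nonneg Y ht₀ ht₁

end IsUnitarilyInvariant

end UnitarilyInvariant

section Young

lemma sqrt_mul_rpow_two_mul {x y : ℝ} (hx : 0 ≤ x) (hy : 0 ≤ y) (t : ℝ) :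
    √(x * y) ^ (2 * t) = x ^ t * y ^ t := by
  rw [Real.rpow_mul (Real.sqrt_nonneg _), Real.rpow_two, Real.sq_sqrt (mul_nonneg hx hy),
    Real.mul_rpow hx hy]

lemma rpow_mul_sqrt_mul_rpow {x y t : ℝ} (hx : 0 ≤ x) (hy : 0 ≤ y) (ht₀ : 0 ≤ t)
    (ht : t ≤ 1 / 2) : x ^ (1 - 2 * t) * √(x * y) ^ (2 * t) = x ^ (1 - t) * y ^ t := by
  rw [sqrt_mul_rpow_two_mul hx hy, ← mul_assoc, ← Real.rpow_add_of_nonneg hx (by linarith) ht₀]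
  ring_nf

lemma rpow_mul_rpow_add_mul_sq_le {x y t : ℝ} (hx : 0 ≤ x) (hy : 0 ≤ y) (ht₀ : 0 ≤ t)
    (ht : t ≤ 1 / 2) :
    x ^ (1 - t) * y ^ t + t * (√x - √y) ^ 2 ≤ (1 - t) * x + t * y := by
  have young : x ^ (1 - t) * y ^ t ≤ (1 - 2 * t) * x + 2 * t * (√x * √y) := by
    rw [← rpow_mul_sqrt_mul_rpow hx hy ht₀ ht, ← Real.sqrt_mul hx]
    exact Real.geom_mean_le_arith_mean2_weighted (by linarith) (by linarith) hx
      (Real.sqrt_nonneg _) (by ring)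
  calc x ^ (1 - t) * y ^ t + t * (√x - √y) ^ 2
      ≤ (1 - 2 * t) * x + 2 * t * (√x * √y) + t * (√x - √y) ^ 2 := by gcongr
    _ = (1 - 2 * t) * x + t * √x ^ 2 + t * √y ^ 2 := by ring
    _ = (1 - t) * x + t * y := by rw [Real.sq_sqrt hx, Real.sq_sqrt hy]; ring

/-- The Kittaneh–Manasrah refinement of Young's inequality. -/
lemma rpow_mul_rpow_add_min_mul_sq_le {x y t : ℝ} (hx : 0 ≤ x) (hy : 0 ≤ y) (ht₀ : 0 ≤ t)
    (ht₁ : t ≤ 1) :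
    x ^ (1 - t) * y ^ t + min t (1 - t) * (√x - √y) ^ 2 ≤ (1 - t) * x + t * y := by
  rcases le_total t (1 / 2) with h | h
  · rw [min_eq_left (by linarith)]
    exact rpow_mul_rpow_add_mul_sq_le hx hy ht₀ h
  · rw [min_eq_right (by linarith), sub_sq_comm, mul_comm (x ^ (1 - t)), add_comm ((1 - t) * x)]
    simpa only [sub_sub_cancel] using
      rpow_mul_rpow_add_mul_sq_le hy hx (t := 1 - t) (by linarith) (by linarith)

lemma rpow_mul_rpow_add_min_mul_sq_fourth_root_le {a b ν : ℝ} (ha : 0 ≤ a) (hb : 0 ≤ b)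
    (hν₀ : 0 ≤ ν) (hν₁ : ν ≤ 1 / 2) :
    a ^ (1 - ν) * b ^ ν + min (2 * ν) (1 - 2 * ν) * (√a - (a * b) ^ (1 / 4 : ℝ)) ^ 2 ≤
      (1 - 2 * ν) * a + 2 * ν * √(a * b) := by
  have fourth_root : (a * b) ^ (1 / 4 : ℝ) = √√(a * b) := by
    rw [Real.sqrt_eq_rpow, Real.sqrt_eq_rpow, ← Real.rpow_mul (mul_nonneg ha hb)]
    norm_num
  rw [← rpow_mul_sqrt_mul_rpow ha hb hν₀ hν₁, fourth_root]
  exact rpow_mul_rpow_add_min_mul_sq_le ha (Real.sqrt_nonneg _) (by linarith) (by linarith)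

end Young

theorem proposition3p14_general {m k : Type*} [Fintype m] [DecidableEq m] [Fintype k]
    [DecidableEq k] {N : Seminorm ℂ (Matrix m k ℂ)} (hN : IsUnitarilyInvariant N)
    {A : Matrix m m ℂ} {B : Matrix k k ℂ} (hA : A.PosSemidef) (hB : B.PosSemidef)
    (X : Matrix m k ℂ) {ν : ℝ} (hν₀ : 0 < ν) (hν₁ : ν ≤ 1 / 2) :
    N (cfc (fun x : ℝ => x ^ (1 - ν)) A * X * cfc (fun x : ℝ => x ^ ν) B +
        cfc (fun x : ℝ => x ^ ν) A * X * cfc (fun x : ℝ => x ^ (1 - ν)) B) ≤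
      (1 - 2 * ν) * (N (A * X) + N (X * B)) +
        (2 * (2 * ν * √(N (A * X) * N (X * B))) -
          min (2 * ν) (1 - 2 * ν) * ((√(N (A * X)) - (N (A * X) * N (X * B)) ^ (1 / 4 : ℝ)) ^ 2 +
            (√(N (X * B)) - (N (A * X) * N (X * B)) ^ (1 / 4 : ℝ)) ^ 2)) := by
  have interp := hN.cfc_rpow_mul_mul_le hA hB X hν₀ (by linarith)
  have interp_symm := hN.cfc_rpow_mul_mul_le hA hB X (t := 1 - ν) (by linarith) (by linarith)
  have triangle := map_add_le_add N
    (cfc (fun x : ℝ => x ^ (1 - ν)) A * X * cfc (fun x : ℝ => x ^ ν) B)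
    (cfc (fun x : ℝ => x ^ ν) A * X * cfc (fun x : ℝ => x ^ (1 - ν)) B)
  rw [sub_sub_cancel] at interp_symm
  have ha : 0 ≤ N (A * X) := apply_nonneg N _
  have hb : 0 ≤ N (X * B) := apply_nonneg N _
  have young := rpow_mul_rpow_add_min_mul_sq_fourth_root_le ha hb hν₀.le hν₁
  have young_symm := rpow_mul_rpow_add_min_mul_sq_fourth_root_le hb ha hν₀.le hν₁
  rw [mul_comm (N (X * B)) (N (A * X))] at young_symm
  linarith

theorem proposition3p14 {n : ℕ} (N : Seminorm ℂ (Matrix (Fin n) (Fin n) ℂ))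
    (hN : IsUnitarilyInvariantNorm N)
    (A B X : Matrix (Fin n) (Fin n) ℂ) (hA : A.PosSemidef) (hB : B.PosSemidef)
    (ν r r₀ : ℝ) (hν₀ : 0 < ν) (hν₁ : ν ≤ 1 / 2)
    (hr : r = min ν (1 - ν)) (hr₀ : r₀ = min (2 * r) (1 - 2 * r)) :
    N (matrixRpow A (1 - ν) * X * matrixRpow B ν + matrixRpow A ν * X * matrixRpow B (1 - ν)) ≤
      (1 - 2 * ν) * (N (A * X) + N (X * B)) +
        (2 * (2 * ν * √(N (A * X) * N (X * B))) -
          r₀ * ((√(N (A * X)) - (N (A * X) * N (X * B)) ^ (1 / 4 : ℝ)) ^ 2 +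
            (√(N (X * B)) - (N (A * X) * N (X * B)) ^ (1 / 4 : ℝ)) ^ 2)) := by
  obtain rfl : r = ν := by rw [hr, min_eq_left (by linarith)]
  exact hr₀ ▸ proposition3p14_general hN.unitary_mul_mul hA hB X hν₀ hν₁
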